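/- Let $N\ge 0$, $m\ge 1$, let $\mathbb T^N=\mathbb R^N/\mathbb Z^N$ and $\mathbb 1=(1,\dots,1)^T\in\mathbb R^m$. Let $H_1,\dots,H_m:\mathbb T^N\times\mathbb R^N\to\mathbb R$ be convex coercive Hamiltonians: each $H_i$ is continuous, $p\mapsto H_i(x,p)$ is convex for every $x$, and there are $\alpha_i,\beta_i:[0,\infty)\to\mathbb R$ tending to $+\infty$ at $+\infty$ with $\alpha_i(|p|)\le H_i(x,p)\le\beta_i(|p|)$ for all $(x,p)$. Let $B=(b_{ij})$ be a constant real $m\times m$ matrix with $b_{ij}\le 0$ for $j\ne i$ and $\sum_j b_{ij}=0$ for every $i$, which is irreducible: for every nonempty proper $\mathcal I\subset\{1,\dots,m\}$ there are $i\in\mathcal I$, $j\notin\mathcal I$ with $b_{ij}\neq0$. For continuous Hamiltonians $G=(G_1,\dots,G_m)$ and $a\in\mathbb R$, let $\mathcal H_G(a)$ be the set of continuous viscosity subsolutions $\mathbf u:\mathbb T^N\to\mathbb R^m$ of the system $G_i(x,Du_i)+(B\mathbf u(x))_i=a$ in $\mathbb T^N$, $i=1,\dots,m$. The critical value of the system is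 $c_G=\inf\{a\in\mathbb R:\mathcal H_G(a)\ne\varnothing\}$, and its Aubry set is $$\mathcal A_G=\{y\in\mathbb T^N:\ \Phi^G_{\cdot,i}(y,\cdot)\text{ is a viscosity solution of the system with } a=c_G\},\qquad \Phi^G_{j,i}(y,x)=\sup_{\mathbf v\in\mathcal H_G(c_G)}\big(v_j(x)-v_i(y)\big),$$ where $i\in\{1,\dots,m\}$ is any fixed index. For $\boldsymbol\lambda\in\mathbb R^m$ let $c_{\boldsymbol\lambda}$ and $\mathcal A_{\boldsymbol\lambda}$ be the critical value and the Aubry set of the system with Hamiltonians $H_i-\lambda_i$, $i=1,\dots,m$. Then, for every $\boldsymbol\lambda\in\mathbb R^m$, there is a unique real number $\pi(\boldsymbol\lambda)$ such that $\boldsymbol\lambda-\pi(\boldsymbol\lambda)\mathbb 1\in\mathrm{Im}(B)$, the critical value $c_{\boldsymbol\lambda}$ is finite, and $$c_{\boldsymbol\lambda}=c_{\mathbf 0}-\pi(\boldsymbol\lambda),\qquad \mathcal A_{\boldsymbol\lambda}=\mathcal A_{\mathbf 0}$$ (the last equality for each choice of the index $i$, the same on both sides). -/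

import Mathlib

open Filter Topology Set

noncomputable section

namespace WeaklyCoupled

/-- The momentum space `ℝ^N`, with its Euclidean norm. -/
abbrev Momentum (N : ℕ) : Type := EuclideanSpace ℝ (Fin N)

/-- The flat torus `𝕋^N = ℝ^N / ℤ^N`. -/
abbrev Torus (N : ℕ) : Type := UnitAddTorus (Fin N)

/-- The canonical projection `ℝ^N → 𝕋^N`. The maps `z ↦ x + proj z`, restricted to small balls
around `0`, are the flat charts of the torus centered at `x`. -/
def proj {N : ℕ} (z : Momentum N) : Torus N := fun k => ((z k : ℝ) : UnitAddCircle)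

/-! ### Coupling matrices -/

/-- A coupling matrix: nonpositive entries off the diagonal, nonnegative row sums. -/
def IsCoupling {m : ℕ} (B : Matrix (Fin m) (Fin m) ℝ) : Prop :=
  (∀ i j, j ≠ i → B i j ≤ 0) ∧ ∀ i, 0 ≤ ∑ j, B i j

/-- A matrix is degenerate if all its row sums vanish. -/
def IsDegenerate {m : ℕ} (B : Matrix (Fin m) (Fin m) ℝ) : Prop :=
  ∀ i, ∑ j, B i j = 0

/-- A matrix is irreducible if for every nonempty proper set of indices `I` there are `i ∈ I` and
`j ∉ I` with `B i j ≠ 0`. -/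
def IsIrreducible {m : ℕ} (B : Matrix (Fin m) (Fin m) ℝ) : Prop :=
  ∀ I : Set (Fin m), I.Nonempty → I ≠ univ → ∃ i ∈ I, ∃ j ∉ I, B i j ≠ 0

/-! ### Hamiltonians -/

/-- A convex Hamiltonian: continuous in `(x, p)`, convex in `p`, and bounded below and above by
coercive functions of `|p|`. -/
structure IsConvexHamiltonian {N : ℕ} (H : Torus N → Momentum N → ℝ) : Prop where
  continuous : Continuous fun z : Torus N × Momentum N => H z.1 z.2
  convex : ∀ x, ConvexOn ℝ univ (H x)
  coercive : ∃ α β : ℝ → ℝ, Tendsto α atTop atTop ∧ Tendsto β atTop atTop ∧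
    ∀ x p, α ‖p‖ ≤ H x p ∧ H x p ≤ β ‖p‖

/-! ### Viscosity solutions -/

/-- The superdifferential `D⁺u(x)`: gradients at `x` of functions `φ`, of class `C¹` near `x`,
such that `u - φ` has a local maximum at `x`; everything is read in the flat chart at `x`. -/
def superdiff {N : ℕ} (u : Torus N → ℝ) (x : Torus N) : Set (Momentum N) :=
  {p | ∃ φ : Momentum N → ℝ, ContDiffAt ℝ 1 φ 0 ∧ HasGradientAt φ p 0 ∧
    IsLocalMax (fun z => u (x + proj z) - φ z) 0}

/-- The subdifferential `D⁻u(x)`: the same with local minima. -/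
def subdiff {N : ℕ} (u : Torus N → ℝ) (x : Torus N) : Set (Momentum N) :=
  {p | ∃ φ : Momentum N → ℝ, ContDiffAt ℝ 1 φ 0 ∧ HasGradientAt φ p 0 ∧
    IsLocalMin (fun z => u (x + proj z) - φ z) 0}

/-- `u` is a (continuous) viscosity subsolution of
`H_i(x, Du_i) + (B(x) u(x))_i = a_i` in `𝕋^N`, `i = 1, …, m`. -/
def IsSubsolution {N m : ℕ} (H : Fin m → Torus N → Momentum N → ℝ)
    (B : Torus N → Matrix (Fin m) (Fin m) ℝ) (a : Fin m → ℝ) (u : Torus N → Fin m → ℝ) : Prop :=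
  Continuous u ∧ ∀ x i, ∀ p ∈ superdiff (fun y => u y i) x,
    H i x p + (B x).mulVec (u x) i ≤ a i

/-- `u` is a (continuous) viscosity supersolution of the same system. -/
def IsSupersolution {N m : ℕ} (H : Fin m → Torus N → Momentum N → ℝ)
    (B : Torus N → Matrix (Fin m) (Fin m) ℝ) (a : Fin m → ℝ) (u : Torus N → Fin m → ℝ) : Prop :=
  Continuous u ∧ ∀ x i, ∀ p ∈ subdiff (fun y => u y i) x,
    a i ≤ H i x p + (B x).mulVec (u x) i

/-- `u` is a (continuous) viscosity solution of the same system. -/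
def IsSolution {N m : ℕ} (H : Fin m → Torus N → Momentum N → ℝ)
    (B : Torus N → Matrix (Fin m) (Fin m) ℝ) (a : Fin m → ℝ) (u : Torus N → Fin m → ℝ) : Prop :=
  IsSubsolution H B a u ∧ IsSupersolution H B a u

/-- `𝓗(a)`: the set of viscosity subsolutions with right-hand side `a 𝟙`. -/
def subsolutions {N m : ℕ} (H : Fin m → Torus N → Momentum N → ℝ)
    (B : Torus N → Matrix (Fin m) (Fin m) ℝ) (a : ℝ) : Set (Torus N → Fin m → ℝ) :=
  {u | IsSubsolution H B (fun _ => a) u}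

/-! ### Critical value, Mañé matrix, Aubry set -/

/-- The levels `a` for which `𝓗(a)` is nonempty. -/
def admissibleLevels {N m : ℕ} (H : Fin m → Torus N → Momentum N → ℝ)
    (B : Torus N → Matrix (Fin m) (Fin m) ℝ) : Set ℝ :=
  {a | (subsolutions H B a).Nonempty}

/-- The critical value `c = inf {a | 𝓗(a) ≠ ∅}`. -/
def criticalValue {N m : ℕ} (H : Fin m → Torus N → Momentum N → ℝ)
    (B : Torus N → Matrix (Fin m) (Fin m) ℝ) : ℝ :=
  sInf (admissibleLevels H B)

/-- The Mañé matrix `Φ_{i,j}(y, x) = sup {v_i(x) - v_j(y) | v ∈ 𝓗(c)}`. The supremum is taken in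
the extended reals, so that no convention about empty or unbounded sets intervenes. -/
def maneMatrix {N m : ℕ} (H : Fin m → Torus N → Momentum N → ℝ)
    (B : Torus N → Matrix (Fin m) (Fin m) ℝ) (i j : Fin m) (y x : Torus N) : EReal :=
  ⨆ v ∈ subsolutions H B (criticalValue H B), ((v x i - v y j : ℝ) : EReal)

/-- The Aubry set, computed with the index `i`: the points `y` such that `Φ_{·,i}(y, ·)` is
(finite and) a critical solution, that is, a viscosity solution with right-hand side `c 𝟙`. -/
def aubrySet {N m : ℕ} (H : Fin m → Torus N → Momentum N → ℝ)
    (B : Torus N → Matrix (Fin m) (Fin m) ℝ) (i : Fin m) : Set (Torus N) :=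
  {y | ∃ u : Torus N → Fin m → ℝ, (∀ x j, (u x j : EReal) = maneMatrix H B j i y x) ∧
    IsSolution H B (fun _ => criticalValue H B) u}

/-- The Hamiltonians `H_i - λ_i`. -/
def shiftHamiltonian {N m : ℕ} (H : Fin m → Torus N → Momentum N → ℝ) (lam : Fin m → ℝ) :
    Fin m → Torus N → Momentum N → ℝ :=
  fun i x p => H i x p - lam i

end WeaklyCoupled

end

open WeaklyCoupled

/-! ### The linear algebra of degenerate irreducible coupling matrices -/

section Coupling

variable {m : ℕ} {B : Matrix (Fin m) (Fin m) ℝ}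

/-! Adding a constant vector `w` to `u` leaves all sub- and superdifferentials unchanged and adds `B
w` to the coupling term. So if `lam = mu + B w + r 𝟙`, translation by `w` carries sub- and
supersolutions for `mu` at level `a` to those for `lam` at level `a - r`, with inverse translation
by `-w`. Hence the critical value drops by `r`, and the Mañé matrix changes only by the constants `w
j - w i`, which preserves the Aubry set. Such a decomposition exists with `mu = 0` and a unique `r`:
by the maximum principle for `B`, its kernel is the line of constants and its image meets that line
only at `0`. -/

theorem mulVec_apply_eq_sum_sub (hBd : IsDegenerate B) (w : Fin m → ℝ) (i : Fin m) :
    B.mulVec w i = ∑ j, B i j * (w j - w i) := by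
  simp only [mul_sub, Finset.sum_sub_distrib, ← Finset.sum_mul, hBd i, zero_mul, sub_zero]
  rfl

theorem mul_sub_nonneg_of_forall_le (hBc : IsCoupling B) {w : Fin m → ℝ} {i : Fin m}
    (hi : ∀ j, w j ≤ w i) (j : Fin m) : 0 ≤ B i j * (w j - w i) := by
  rcases eq_or_ne j i with rfl | hj
  · simp
  · exact mul_nonneg_of_nonpos_of_nonpos (hBc.1 i j hj) (sub_nonpos.2 (hi j))

theorem mulVec_nonneg_of_forall_le (hBc : IsCoupling B) (hBd : IsDegenerate B) {w : Fin m → ℝ}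
    {i : Fin m} (hi : ∀ j, w j ≤ w i) : 0 ≤ B.mulVec w i := by
  rw [mulVec_apply_eq_sum_sub hBd]
  exact Finset.sum_nonneg fun j _ => mul_sub_nonneg_of_forall_le hBc hi j

theorem mulVec_const_eq_zero (hBd : IsDegenerate B) (c : ℝ) : B.mulVec (fun _ => c) = 0 := by
  ext i
  simp [mulVec_apply_eq_sum_sub hBd]

/-- Constant vectors in the image of `B` vanish. -/
theorem eq_zero_of_mulVec_eq_const (hm : 0 < m) (hBc : IsCoupling B) (hBd : IsDegenerate B)
    {w : Fin m → ℝ} {c : ℝ} (h : B.mulVec w = fun _ => c) : c = 0 := by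
  have : Nonempty (Fin m) := ⟨⟨0, hm⟩⟩
  have key : ∀ (v : Fin m → ℝ) (d : ℝ), (B.mulVec v = fun _ => d) → 0 ≤ d := by
    intro v d hv
    obtain ⟨i, hi⟩ := Finite.exists_max v
    simpa [hv] using mulVec_nonneg_of_forall_le hBc hBd hi
  refine le_antisymm ?_ (key w c h)
  -- A minimum of `w` is a maximum of `-w`, which gives the opposite sign.
  have := key (-w) (-c) (by rw [Matrix.mulVec_neg, h]; rfl)
  linarith

/-- The kernel of `B` consists of constant vectors. -/
theorem eq_of_mulVec_eq_zero (hBc : IsCoupling B) (hBi : IsIrreducible B) (hBd : IsDegenerate B)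
    {w : Fin m → ℝ} (h : B.mulVec w = 0) (k l : Fin m) : w k = w l := by
  have : Nonempty (Fin m) := ⟨k⟩
  obtain ⟨i₀, hi₀⟩ := Finite.exists_max w
  suffices hI : {i | w i = w i₀} = univ by
    have hk : k ∈ {i | w i = w i₀} := hI ▸ mem_univ k
    have hl : l ∈ {i | w i = w i₀} := hI ▸ mem_univ l
    exact hk.trans hl.symm
  by_contra hI
  -- Strong maximum principle: a nonzero entry leads out of the set of maximizers, yet row `i` is a
  -- vanishing sum of nonnegative terms.
  obtain ⟨i, hi, j, hj, hij⟩ := hBi {i | w i = w i₀} ⟨i₀, rfl⟩ hI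
  have hi' : w i = w i₀ := hi
  have hmax : ∀ j, w j ≤ w i := fun j => hi' ▸ hi₀ j
  have hsum : ∑ j, B i j * (w j - w i) = 0 := by
    rw [← mulVec_apply_eq_sum_sub hBd, h]; rfl
  have hterm := (Finset.sum_eq_zero_iff_of_nonneg
    fun j _ => mul_sub_nonneg_of_forall_le hBc hmax j).1 hsum j (Finset.mem_univ j)
  rcases mul_eq_zero.1 hterm with h0 | h0
  · exact hij h0
  · exact hj ((sub_eq_zero.1 h0).trans hi')

/-- `ℝ^m` is the sum of `Im B` and of the line of constant vectors. -/
theorem exists_mulVec_add_const (hm : 0 < m) (hBc : IsCoupling B) (hBi : IsIrreducible B)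
    (hBd : IsDegenerate B) (lam : Fin m → ℝ) :
    ∃ (w : Fin m → ℝ) (r : ℝ), lam = B.mulVec w + fun _ => r := by
  -- Adding one coordinate of `w`, as a constant vector, to `B w` gives an injective, hence
  -- surjective, endomorphism; that coordinate is then `r`.
  let T : (Fin m → ℝ) →ₗ[ℝ] (Fin m → ℝ) :=
    B.mulVecLin + LinearMap.pi fun _ => LinearMap.proj ⟨0, hm⟩
  have hT : ∀ w, T w = B.mulVec w + fun _ => w ⟨0, hm⟩ := fun w => rfl
  have hinj : Function.Injective T := by
    refine (injective_iff_map_eq_zero T).2 fun w hw => ?_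
    rw [hT] at hw
    have h0 : w ⟨0, hm⟩ = 0 := by
      refine neg_eq_zero.1 (eq_zero_of_mulVec_eq_const hm hBc hBd (w := w) ?_)
      rw [eq_neg_of_add_eq_zero_left hw]; rfl
    have hw0 : B.mulVec w = 0 := by
      rw [h0] at hw
      exact (add_zero _).symm.trans hw
    ext k
    rw [eq_of_mulVec_eq_zero hBc hBi hBd hw0 k ⟨0, hm⟩, h0]; rfl
  obtain ⟨w, hw⟩ := LinearMap.injective_iff_surjective.1 hinj lam
  exact ⟨w, w ⟨0, hm⟩, by rw [← hw, hT]⟩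

theorem existsUnique_sub_const_mem_range (hm : 0 < m) (hBc : IsCoupling B)
    (hBi : IsIrreducible B) (hBd : IsDegenerate B) (lam : Fin m → ℝ) :
    ∃! r : ℝ, (lam - fun _ => r) ∈ LinearMap.range B.mulVecLin := by
  obtain ⟨w, r, hw⟩ := exists_mulVec_add_const hm hBc hBi hBd lam
  refine ⟨r, ⟨w, by rw [hw, Matrix.mulVecLin_apply, add_sub_cancel_right]⟩, ?_⟩
  rintro s ⟨v, hv⟩
  rw [Matrix.mulVecLin_apply] at hv
  have : s - r = 0 := by
    refine eq_zero_of_mulVec_eq_const hm hBc hBd (w := w - v) ?_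
    rw [Matrix.mulVec_sub, hv, hw]
    ext i
    simp only [Pi.sub_apply, Pi.add_apply]
    ring
  linarith

end Coupling

/-! ### Sub- and superdifferentials -/

section Differentials

variable {N : ℕ}

theorem superdiff_add_const (u : Torus N → ℝ) (c : ℝ) (x : Torus N) :
    superdiff (fun y => u y + c) x = superdiff u x := by
  simp only [superdiff, IsLocalMax, IsMaxFilter, add_sub_right_comm, add_le_add_iff_right]

theorem subdiff_add_const (u : Torus N → ℝ) (c : ℝ) (x : Torus N) :
    subdiff (fun y => u y + c) x = subdiff u x := by
  simp only [subdiff, IsLocalMin, IsMinFilter, add_sub_right_comm, add_le_add_iff_right]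

theorem proj_zero : proj (0 : Momentum N) = 0 := by
  ext k
  simp [proj]

theorem zero_mem_superdiff_of_forall_le {u : Torus N → ℝ} {x : Torus N} (h : ∀ y, u y ≤ u x) :
    (0 : Momentum N) ∈ superdiff u x := by
  refine ⟨fun _ => 0, contDiffAt_const, hasGradientAt_const 0 0, Eventually.of_forall fun z => ?_⟩
  simpa [proj_zero] using h (x + proj z)

theorem eq_zero_of_mem_superdiff_const {c : ℝ} {x : Torus N} {p : Momentum N}
    (hp : p ∈ superdiff (fun _ => c) x) : p = 0 := by
  obtain ⟨φ, -, hφ, hmax⟩ := hp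
  have hmin : IsLocalMin φ 0 := by
    filter_upwards [hmax] with z hz
    linarith
  have := hmin.hasFDerivAt_eq_zero hφ.hasFDerivAt
  simpa using this

end Differentials

/-! ### Translating solutions by constant vectors -/

section Translation

variable {N m : ℕ} {H : Fin m → Torus N → Momentum N → ℝ} {B : Matrix (Fin m) (Fin m) ℝ}
  {lam mu w : Fin m → ℝ} {a r : ℝ} {u : Torus N → Fin m → ℝ}

theorem IsSubsolution_add (h : lam = mu + B.mulVec w + fun _ => r)
    (hu : IsSubsolution (shiftHamiltonian H mu) (fun _ => B) (fun _ => a) u) :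
    IsSubsolution (shiftHamiltonian H lam) (fun _ => B) (fun _ => a - r) (fun x => u x + w) := by
  refine ⟨hu.1.add continuous_const, fun x i p hp => ?_⟩
  have hp' : p ∈ superdiff (fun y => u y i) x := by
    rwa [← superdiff_add_const (fun y => u y i) (w i)]
  have := hu.2 x i p hp'
  simp only [shiftHamiltonian, h, Matrix.mulVec_add, Pi.add_apply] at this ⊢
  linarith

theorem IsSupersolution_add (h : lam = mu + B.mulVec w + fun _ => r)
    (hu : IsSupersolution (shiftHamiltonian H mu) (fun _ => B) (fun _ => a) u) :
    IsSupersolution (shiftHamiltonian H lam) (fun _ => B) (fun _ => a - r)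
      (fun x => u x + w) := by
  refine ⟨hu.1.add continuous_const, fun x i p hp => ?_⟩
  have hp' : p ∈ subdiff (fun y => u y i) x := by
    rwa [← subdiff_add_const (fun y => u y i) (w i)]
  have := hu.2 x i p hp'
  simp only [shiftHamiltonian, h, Matrix.mulVec_add, Pi.add_apply] at this ⊢
  linarith

/-- The relation is symmetric, so each later equality needs only one inequality or inclusion. -/
theorem eq_add_mulVec_neg (h : lam = mu + B.mulVec w + fun _ => r) :
    mu = lam + B.mulVec (-w) + fun _ => -r := by
  rw [h, Matrix.mulVec_neg]
  ext i
  simp only [Pi.add_apply, Pi.neg_apply]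
  ring

end Translation

/-! ### Critical values and Aubry sets -/

section Critical

variable {N m : ℕ} {H : Fin m → Torus N → Momentum N → ℝ} {B : Matrix (Fin m) (Fin m) ℝ}
  {lam mu w : Fin m → ℝ} {r : ℝ}

theorem admissibleLevels_nonempty (hH : ∀ i, IsConvexHamiltonian (H i)) (hBd : IsDegenerate B)
    (lam : Fin m → ℝ) :
    (admissibleLevels (shiftHamiltonian H lam) (fun _ => B)).Nonempty := by
  choose α β _ _ hb using fun i => (hH i).coercive
  obtain ⟨M, hM⟩ := (Set.finite_range fun i => β i 0 - lam i).bddAbove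
  -- The zero function is a subsolution at a high enough level.
  refine ⟨M, fun _ _ => 0, continuous_const, fun x i p hp => ?_⟩
  rw [eq_zero_of_mem_superdiff_const hp, mulVec_const_eq_zero hBd]
  have h1 := (hb i x 0).2
  have h2 : β i 0 - lam i ≤ M := hM ⟨i, rfl⟩
  rw [norm_zero] at h1
  simp only [shiftHamiltonian, Pi.zero_apply]
  linarith

theorem admissibleLevels_bddBelow (hm : 0 < m) (hH : ∀ i, IsConvexHamiltonian (H i))
    (hBc : IsCoupling B) (hBd : IsDegenerate B) (lam : Fin m → ℝ) :
    BddBelow (admissibleLevels (shiftHamiltonian H lam) (fun _ => B)) := by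
  have : Nonempty (Fin m) := ⟨⟨0, hm⟩⟩
  choose α β _ _ hb using fun i => (hH i).coercive
  obtain ⟨M, hM⟩ := (Set.finite_range fun i => α i 0 - lam i).bddBelow
  refine ⟨M, ?_⟩
  rintro a ⟨u, hu⟩
  have hmax : ∀ i, ∃ x, ∀ y, u y i ≤ u x i := fun i => by
    obtain ⟨x, -, hx⟩ := isCompact_univ.exists_isMaxOn univ_nonempty
      ((continuous_apply i).comp hu.1).continuousOn
    exact ⟨x, fun y => hx (mem_univ y)⟩
  choose x hx using hmax
  -- Maximizing over both points and indices makes `0` a supergradient and the coupling term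
  -- nonnegative there.
  obtain ⟨i, hi⟩ := Finite.exists_max fun i => u (x i) i
  have h1 := hu.2 (x i) i 0 (zero_mem_superdiff_of_forall_le (hx i))
  have h2 : 0 ≤ B.mulVec (u (x i)) i :=
    mulVec_nonneg_of_forall_le hBc hBd fun j => (hx j (x i)).trans (hi j)
  have h3 := (hb i (x i) 0).1
  have h4 : M ≤ α i 0 - lam i := hM ⟨i, rfl⟩
  rw [norm_zero] at h3
  simp only [shiftHamiltonian] at h1
  linarith

theorem isGLB_criticalValue (hm : 0 < m) (hH : ∀ i, IsConvexHamiltonian (H i))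
    (hBc : IsCoupling B) (hBd : IsDegenerate B) (lam : Fin m → ℝ) :
    IsGLB (admissibleLevels (shiftHamiltonian H lam) (fun _ => B))
      (criticalValue (shiftHamiltonian H lam) (fun _ => B)) :=
  isGLB_csInf (admissibleLevels_nonempty hH hBd lam)
    (admissibleLevels_bddBelow hm hH hBc hBd lam)

theorem criticalValue_le_sub (hm : 0 < m) (hH : ∀ i, IsConvexHamiltonian (H i))
    (hBc : IsCoupling B) (hBd : IsDegenerate B) (h : lam = mu + B.mulVec w + fun _ => r) :
    criticalValue (shiftHamiltonian H lam) (fun _ => B) ≤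
      criticalValue (shiftHamiltonian H mu) (fun _ => B) - r := by
  rw [le_sub_iff_add_le]
  refine (isGLB_criticalValue hm hH hBc hBd mu).2 ?_
  rintro a ⟨u, hu⟩
  rw [← le_sub_iff_add_le]
  exact (isGLB_criticalValue hm hH hBc hBd lam).1 ⟨_, IsSubsolution_add h hu⟩

theorem criticalValue_eq_sub (hm : 0 < m) (hH : ∀ i, IsConvexHamiltonian (H i))
    (hBc : IsCoupling B) (hBd : IsDegenerate B) (h : lam = mu + B.mulVec w + fun _ => r) :
    criticalValue (shiftHamiltonian H lam) (fun _ => B) =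
      criticalValue (shiftHamiltonian H mu) (fun _ => B) - r := by
  refine le_antisymm (criticalValue_le_sub hm hH hBc hBd h) ?_
  have := criticalValue_le_sub hm hH hBc hBd (eq_add_mulVec_neg h)
  linarith

theorem maneMatrix_le_add
    (hc : criticalValue (shiftHamiltonian H lam) (fun _ => B) =
      criticalValue (shiftHamiltonian H mu) (fun _ => B) - r)
    (h : lam = mu + B.mulVec w + fun _ => r) (j i : Fin m) (y x : Torus N) :
    maneMatrix (shiftHamiltonian H lam) (fun _ => B) j i y x ≤
      maneMatrix (shiftHamiltonian H mu) (fun _ => B) j i y x + ((w j - w i : ℝ) : EReal) := by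
  refine iSup₂_le fun v hv => ?_
  have hv' : (fun x => v x + -w) ∈ subsolutions (shiftHamiltonian H mu) (fun _ => B)
      (criticalValue (shiftHamiltonian H mu) (fun _ => B)) := by
    have := IsSubsolution_add (eq_add_mulVec_neg h) hv
    rwa [hc, sub_neg_eq_add, sub_add_cancel] at this
  calc ((v x j - v y i : ℝ) : EReal)
      = (((v x + -w) j - (v y + -w) i : ℝ) : EReal) + ((w j - w i : ℝ) : EReal) := by
        rw [← EReal.coe_add]
        congr 1
        simp only [Pi.add_apply, Pi.neg_apply]
        ring
    _ ≤ _ := by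
        gcongr
        exact le_iSup₂_of_le (fun x => v x + -w) hv' le_rfl

theorem aubrySet_subset (hm : 0 < m) (hH : ∀ i, IsConvexHamiltonian (H i))
    (hBc : IsCoupling B) (hBd : IsDegenerate B) (h : lam = mu + B.mulVec w + fun _ => r)
    (i : Fin m) :
    aubrySet (shiftHamiltonian H mu) (fun _ => B) i ⊆
      aubrySet (shiftHamiltonian H lam) (fun _ => B) i := by
  rintro y ⟨u, hu, hsol⟩
  have hc := criticalValue_eq_sub hm hH hBc hBd h
  -- Since `B` kills constants, `w` can be normalized to vanish at `i`; translating by it then gives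
  -- exactly the Mañé column for `lam`.
  have h' : lam = mu + B.mulVec (fun j => w j - w i) + fun _ => r := by
    have : (fun j => w j - w i) = w - fun _ => w i := rfl
    rw [this, Matrix.mulVec_sub, mulVec_const_eq_zero hBd, sub_zero, h]
  refine ⟨fun x => u x + fun j => w j - w i, fun x j => le_antisymm ?_ ?_, ?_⟩
  · have hle := maneMatrix_le_add
      (criticalValue_eq_sub hm hH hBc hBd (eq_add_mulVec_neg h)) (eq_add_mulVec_neg h) j i y x
    rw [← hu] at hle
    calc ((u x j + (w j - w i) : ℝ) : EReal)
        = (u x j : EReal) + ((w j - w i : ℝ) : EReal) := EReal.coe_add _ _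
      _ ≤ maneMatrix (shiftHamiltonian H lam) (fun _ => B) j i y x +
            (((-w) j - (-w) i : ℝ) : EReal) + ((w j - w i : ℝ) : EReal) := by gcongr
      _ = maneMatrix (shiftHamiltonian H lam) (fun _ => B) j i y x := by
        rw [add_assoc, ← EReal.coe_add]
        have : (-w) j - (-w) i + (w j - w i) = 0 := by
          simp only [Pi.neg_apply]
          ring
        rw [this, EReal.coe_zero, add_zero]
  · have hle := maneMatrix_le_add hc h j i y x
    rwa [← hu, ← EReal.coe_add] at hle
  · rw [hc]
    exact ⟨IsSubsolution_add h' hsol.1, IsSupersolution_add h' hsol.2⟩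

end Critical

theorem mainTheorem10 {N m : ℕ} (hm : 0 < m)
    (H : Fin m → WeaklyCoupled.Torus N → WeaklyCoupled.Momentum N → ℝ)
    (hH : ∀ i, WeaklyCoupled.IsConvexHamiltonian (H i))
    (B : Matrix (Fin m) (Fin m) ℝ)
    (hBc : WeaklyCoupled.IsCoupling B)
    (hBi : WeaklyCoupled.IsIrreducible B)
    (hBd : WeaklyCoupled.IsDegenerate B)
    (lam : Fin m → ℝ) :
    (∃! r : ℝ, (lam - fun _ => r) ∈ LinearMap.range B.mulVecLin) ∧
    IsGLB (WeaklyCoupled.admissibleLevels (WeaklyCoupled.shiftHamiltonian H lam) (fun _ => B))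
      (WeaklyCoupled.criticalValue (WeaklyCoupled.shiftHamiltonian H lam) (fun _ => B)) ∧
    (∀ r : ℝ, (lam - fun _ => r) ∈ LinearMap.range B.mulVecLin →
      WeaklyCoupled.criticalValue (WeaklyCoupled.shiftHamiltonian H lam) (fun _ => B) =
        WeaklyCoupled.criticalValue (WeaklyCoupled.shiftHamiltonian H 0) (fun _ => B) - r) ∧
    ∀ i : Fin m,
      WeaklyCoupled.aubrySet (WeaklyCoupled.shiftHamiltonian H lam) (fun _ => B) i =
        WeaklyCoupled.aubrySet (WeaklyCoupled.shiftHamiltonian H 0) (fun _ => B) i := by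
  have hex := existsUnique_sub_const_mem_range hm hBc hBi hBd lam
  have hdecomp : ∀ r : ℝ, (lam - fun _ => r) ∈ LinearMap.range B.mulVecLin →
      ∃ w : Fin m → ℝ, lam = 0 + B.mulVec w + fun _ => r := by
    rintro r ⟨w, hw⟩
    rw [Matrix.mulVecLin_apply] at hw
    exact ⟨w, by rw [hw, zero_add, sub_add_cancel]⟩
  refine ⟨hex, isGLB_criticalValue hm hH hBc hBd lam, fun r hr => ?_, fun i => ?_⟩
  · obtain ⟨w, hw⟩ := hdecomp r hr
    exact criticalValue_eq_sub hm hH hBc hBd hw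
  · obtain ⟨r, hr, -⟩ := hex
    obtain ⟨w, hw⟩ := hdecomp r hr
    exact (aubrySet_subset hm hH hBc hBd (eq_add_mulVec_neg hw) i).antisymm
      (aubrySet_subset hm hH hBc hBd hw i)
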